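/- **Proposition (Albanese variety of a Bagnera–de Franchis variety).** Let $A_i=V_i/\Lambda_i$ ($i=1,2$) be complex Abelian varieties, with $V_i$ a finite-dimensional complex vector space and $\Lambda_i\subset V_i$ a lattice. Let $m\ge 2$, let $\beta_1\in A_1$ be an element of order exactly $m$, and let $\alpha_2\colon A_2\to A_2$ be a linear automorphism of order exactly $m$ that does not have $1$ as an eigenvalue (on $V_2$). Let $T_1\subset A_1$ and $T_2\subset A_2$ be finite subgroups and $T\subset A_1\times A_2$ the graph of an isomorphism $T_1\cong T_2$, such that $\alpha_2(t)=t$ for all $t\in T_2$ and $\langle\beta_1\rangle\cap T_1=\{0\}$. Put $A=(A_1\times A_2)/T$, let $G\cong\mathbb Z/m\mathbb Z$ be the group of automorphisms of $A$ generated by the automorphism $g$ induced by $(a_1,a_2)\mapsto(a_1+\beta_1,\alpha_2(a_2))$, which acts freely on $A$, and let $X=A/G$ be the corresponding Bagnera–de Franchis variety, a complex manifold. Let $$\operatorname{Alb}(X)=H^0(X,\Omega^1_X)^\vee/\operatorname{im}\bigl(H_1(X,\mathbb Z)\bigr)$$ be its Albanese variety, where $H_1(X,\mathbb Z)\to H^0(X,\Omega^1_X)^\vee$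 is given by integration of holomorphic one-forms along loops. Then $$\operatorname{Alb}(X)\;\cong\;A_1/(T_1+\langle\beta_1\rangle)$$ as complex tori, i.e. by a group isomorphism induced by a $\mathbb C$-linear isomorphism $V_1\cong H^0(X,\Omega^1_X)^\vee$. Moreover, for every base point $x_0\in X$, this isomorphism identifies the Albanese map $x\mapsto\bigl[\eta\mapsto\int_{x_0}^x\eta\bigr]$ of $X$ with the map $x\mapsto q(x)-q(x_0)$, where $q\colon X\to A_1/(T_1+\langle\beta_1\rangle)$ is the map induced by the first projection $A_1\times A_2\to A_1$. -/

import Mathlib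

open scoped Manifold ContDiff ComplexConjugate Topology
open Set

noncomputable section

/-! ### Complex manifolds: holomorphic one-forms, periods, the Albanese variety -/

section Albanese

variable (E X : Type*) [NormedAddCommGroup E] [NormedSpace ℂ E]
  [TopologicalSpace X] [ChartedSpace E X]

variable {X} in
/-- `γ`, restricted to `[0,1]`, is a continuously differentiable path in `X`. -/
def IsC1Path (γ : ℝ → X) : Prop :=
  ContMDiffOn 𝓘(ℝ, ℝ) 𝓘(ℝ, E) 1 γ (Icc 0 1)

variable [IsManifold 𝓘(ℂ, E) ω X]

/-- `H⁰(X, Ω¹_X)`: holomorphic sections of the holomorphic cotangent bundle of the complex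
manifold `X`, as a complex vector space. -/
abbrev HolomorphicOneForm : Type _ :=
  Cₛ^ω⟮𝓘(ℂ, E); E →L[ℂ] ℂ,
    fun x : X => TangentSpace 𝓘(ℂ, E) x →L[ℂ] Bundle.Trivial X ℂ x⟯

variable {E X}

/-- The integral `∫_γ η` of a holomorphic one-form along a path `γ : [0,1] → X`. -/
def HolomorphicOneForm.integral (η : HolomorphicOneForm E X) (γ : ℝ → X) : ℂ :=
  ∫ t in (0 : ℝ)..1,
    (η (γ t) : E →L[ℂ] ℂ) (mfderivWithin 𝓘(ℝ, ℝ) 𝓘(ℝ, E) γ (Icc 0 1) t (1 : ℝ) : E)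

variable (E X)

/-- The image of `H₁(X, ℤ)` in `H⁰(X, Ω¹_X)^∨` under `[γ] ↦ (η ↦ ∫_γ η)`: the subgroup generated
by the functionals "integration along a `C¹` loop". -/
def periodGroup : AddSubgroup (Module.Dual ℂ (HolomorphicOneForm E X)) :=
  AddSubgroup.closure
    {φ | ∃ γ : ℝ → X, IsC1Path E γ ∧ γ 0 = γ 1 ∧ ∀ η, φ η = η.integral γ}

/-- The Albanese variety `Alb(X) = H⁰(X, Ω¹_X)^∨ / im H₁(X, ℤ)`. -/
abbrev Albanese : Type _ :=
  Module.Dual ℂ (HolomorphicOneForm E X) ⧸ periodGroup E X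

variable {X}

/-- `a : X → Alb(X)` is the Albanese map with base point `x₀`: for every `C¹` path `γ` from `x₀`,
integration along `γ` is a linear functional on `H⁰(X, Ω¹_X)` and its class modulo periods is
`a (γ 1)`. -/
def IsAlbaneseMap (x₀ : X) (a : X → Albanese E X) : Prop :=
  ∀ γ : ℝ → X, IsC1Path E γ → γ 0 = x₀ →
    ∃ φ : Module.Dual ℂ (HolomorphicOneForm E X),
      (∀ η, φ η = η.integral γ) ∧ a (γ 1) = (φ : Albanese E X)

end Albanese

/-! ### Abelian varieties as polarized complex tori -/

section Torus

variable {V : Type*} [NormedAddCommGroup V] [NormedSpace ℂ V]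

/-- `V / L` is an Abelian variety: `L` is a lattice in the complex vector space `V`, and there is a
positive definite Hermitian form on `V` whose imaginary part is integral on `L`. -/
structure IsAbelianVariety (L : AddSubgroup V) : Prop where
  discrete : DiscreteTopology L
  span_eq_top : Submodule.span ℝ (L : Set V) = ⊤
  polarization : ∃ H : V →ₗ⋆[ℂ] V →ₗ[ℂ] ℂ,
    (∀ x y, H y x = conj (H x y)) ∧ (∀ x, x ≠ 0 → 0 < (H x x).re) ∧
    ∀ x ∈ L, ∀ y ∈ L, ∃ n : ℤ, (H x y).im = n

/-- The automorphism of the torus `V / L` induced by a linear automorphism of `V` preserving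
`L`. -/
def torusAut (L : AddSubgroup V) (α : V ≃L[ℂ] V)
    (h : L.map (α.toLinearEquiv.toAddEquiv : V →+ V) = L) : V ⧸ L ≃+ V ⧸ L :=
  QuotientAddGroup.congr L L α.toLinearEquiv.toAddEquiv h

end Torus

/-! ### Bagnera–de Franchis varieties -/

variable (V₁ V₂ : Type*) [NormedAddCommGroup V₁] [NormedSpace ℂ V₁]
  [NormedAddCommGroup V₂] [NormedSpace ℂ V₂]

/-- The data presenting a Bagnera–de Franchis variety `X = A / G`, `A = (A₁ × A₂) / T`, where
`Aᵢ = Vᵢ / Λᵢ`. -/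
structure BagneraDeFranchis where
  Λ₁ : AddSubgroup V₁
  Λ₂ : AddSubgroup V₂
  abelian₁ : IsAbelianVariety Λ₁
  abelian₂ : IsAbelianVariety Λ₂
  /-- the order of the cyclic group `G` -/
  m : ℕ
  one_lt_m : 1 < m
  /-- the translation part -/
  β₁ : V₁ ⧸ Λ₁
  order_β₁ : addOrderOf β₁ = m
  /-- the linear part -/
  α₂ : V₂ ≃L[ℂ] V₂
  map_α₂ : Λ₂.map (α₂.toLinearEquiv.toAddEquiv : V₂ →+ V₂) = Λ₂
  order_α₂ : orderOf α₂ = m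
  no_eigenvalue_one : ¬ Module.End.HasEigenvalue (α₂.toLinearEquiv : V₂ →ₗ[ℂ] V₂) 1
  T₁ : AddSubgroup (V₁ ⧸ Λ₁)
  T₂ : AddSubgroup (V₂ ⧸ Λ₂)
  finite_T₁ : Finite T₁
  /-- the isomorphism whose graph is `T` -/
  ψ : T₁ ≃+ T₂
  fix_T₂ : ∀ t ∈ T₂, torusAut Λ₂ α₂ map_α₂ t = t
  disjoint_β₁ : Disjoint (AddSubgroup.zmultiples β₁) T₁

namespace BagneraDeFranchis

variable {V₁ V₂}
variable (D : BagneraDeFranchis V₁ V₂)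

abbrev A₁ : Type _ := V₁ ⧸ D.Λ₁

abbrev A₂ : Type _ := V₂ ⧸ D.Λ₂

/-- The finite subgroup `T ⊆ A₁ × A₂`, the graph of `ψ : T₁ ≃ T₂`. -/
def T : AddSubgroup (D.A₁ × D.A₂) :=
  (D.T₁.subtype.prod (D.T₂.subtype.comp D.ψ.toAddMonoidHom)).range

/-- `A = (A₁ × A₂) / T`. -/
abbrev A : Type _ := (D.A₁ × D.A₂) ⧸ D.T

/-- `α₂` as an automorphism of `A₂`. -/
def α₂bar : D.A₂ ≃+ D.A₂ := torusAut D.Λ₂ D.α₂ D.map_α₂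

lemma map_T : D.T.map (((AddEquiv.refl D.A₁).prodCongr D.α₂bar : _ ≃+ _) :
    D.A₁ × D.A₂ →+ D.A₁ × D.A₂) = D.T := by
  have key : ∀ x ∈ D.T, ((AddEquiv.refl D.A₁).prodCongr D.α₂bar) x = x := by
    rintro _ ⟨t, rfl⟩
    exact Prod.ext rfl (D.fix_T₂ _ (D.ψ t).2)
  ext x
  constructor
  · rintro ⟨y, hy, rfl⟩
    have := key y hy
    simp only [AddMonoidHom.coe_coe]
    rw [this]; exact hy
  · intro hx
    exact ⟨x, hx, key x hx⟩

/-- The generator `g` of `G`: the automorphism of `A` induced by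
`(a₁, a₂) ↦ (a₁ + β₁, α₂ a₂)`. -/
def g : Equiv.Perm D.A :=
  (QuotientAddGroup.congr D.T D.T ((AddEquiv.refl D.A₁).prodCongr D.α₂bar) D.map_T).toEquiv.trans
    (Equiv.addRight (((D.β₁, 0) : D.A₁ × D.A₂) : D.A))

lemma g_mk (a₁ : D.A₁) (a₂ : D.A₂) :
    D.g (((a₁, a₂) : D.A₁ × D.A₂) : D.A) = (((a₁ + D.β₁, D.α₂bar a₂) : D.A₁ × D.A₂) : D.A) := by
  change (((a₁ + D.β₁, D.α₂bar a₂ + 0) : D.A₁ × D.A₂) : D.A) = _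
  rw [add_zero]

/-- The cyclic group `G = ⟨g⟩` of automorphisms of `A`. -/
def G : Subgroup (Equiv.Perm D.A) := Subgroup.zpowers D.g

/-- The Bagnera–de Franchis variety `X = A / G`, with the quotient topology. -/
def X : Type _ := MulAction.orbitRel.Quotient D.G D.A

instance : TopologicalSpace D.X :=
  inferInstanceAs (TopologicalSpace (MulAction.orbitRel.Quotient D.G D.A))

/-- The projection `V₁ × V₂ → A`. -/
def toA : V₁ × V₂ →+ D.A :=
  (QuotientAddGroup.mk' D.T).comp
    ((QuotientAddGroup.mk' D.Λ₁).prodMap (QuotientAddGroup.mk' D.Λ₂))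

/-- The projection `A → X`. -/
def mkX (a : D.A) : D.X := Quotient.mk (MulAction.orbitRel D.G D.A) a

/-- The universal covering `V₁ × V₂ → X`. -/
def p (v : V₁ × V₂) : D.X := D.mkX (D.toA v)

lemma g_toA (b : V₁) (hb : (b : D.A₁) = D.β₁) (v : V₁ × V₂) :
    D.g (D.toA v) = D.toA (v.1 + b, D.α₂ v.2) := by
  change D.g ((((v.1 : D.A₁), (v.2 : D.A₂)) : D.A₁ × D.A₂) : D.A) = _
  rw [g_mk, ← hb]
  rfl

lemma g_pow_mk (k : ℕ) (a₁ : D.A₁) (a₂ : D.A₂) :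
    (D.g ^ k) (((a₁, a₂) : D.A₁ × D.A₂) : D.A) =
      (((a₁ + k • D.β₁, D.α₂bar^[k] a₂) : D.A₁ × D.A₂) : D.A) := by
  induction k with
  | zero => simp
  | succ k ih =>
    rw [pow_succ', Equiv.Perm.mul_apply, ih, g_mk, Function.iterate_succ_apply', succ_nsmul,
      add_assoc]

lemma α₂bar_iterate (k : ℕ) (v : V₂) : D.α₂bar^[k] (v : D.A₂) = ((D.α₂ ^ k) v : V₂) := by
  induction k with
  | zero => rfl
  | succ k ih =>
    rw [Function.iterate_succ_apply', ih, pow_succ']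
    rfl

lemma g_pow_m : D.g ^ D.m = 1 := by
  ext a
  induction a using QuotientAddGroup.induction_on with
  | H x =>
    obtain ⟨a₁, a₂⟩ := x
    induction a₂ using QuotientAddGroup.induction_on with
    | H v =>
      rw [g_pow_mk, α₂bar_iterate, ← D.order_β₁, addOrderOf_nsmul_eq_zero, D.order_β₁,
        ← D.order_α₂, pow_orderOf_eq_one, add_zero]
      rfl

lemma isOfFinOrder_g : IsOfFinOrder D.g :=
  isOfFinOrder_iff_pow_eq_one.mpr ⟨D.m, by have := D.one_lt_m; omega, D.g_pow_m⟩

instance : Finite D.G := by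
  have : Finite (Subgroup.zpowers D.g) := finite_zpowers.mpr D.isOfFinOrder_g
  exact this

lemma exists_pow_of_mem_G {h : Equiv.Perm D.A} (hh : h ∈ D.G) : ∃ k : ℕ, h = D.g ^ k := by
  have := (D.isOfFinOrder_g.mem_powers_iff_mem_zpowers).mpr hh
  obtain ⟨k, hk⟩ := this
  exact ⟨k, hk.symm⟩

/-- The action of `G` on `A` is free. -/
lemma free_G (h : D.G) (a : D.A) (ha : h • a = a) : h = 1 := by
  obtain ⟨h, hh⟩ := h
  obtain ⟨k, rfl⟩ := D.exists_pow_of_mem_G hh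
  replace ha : (D.g ^ k) a = a := ha
  apply Subtype.ext
  change D.g ^ k = 1
  induction a using QuotientAddGroup.induction_on with
  | H x =>
    obtain ⟨a₁, a₂⟩ := x
    rw [g_pow_mk, eq_comm, QuotientAddGroup.eq] at ha
    obtain ⟨t, ht⟩ := ha
    have h1 : (t : D.A₁) = k • D.β₁ := by
      have := congrArg Prod.fst ht
      simpa using this
    have h2 : k • D.β₁ = 0 :=
      (AddSubgroup.disjoint_def.mp D.disjoint_β₁)
        (AddSubgroup.nsmul_mem _ (AddSubgroup.mem_zmultiples _) k) (h1 ▸ t.2)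
    obtain ⟨j, rfl⟩ := D.order_β₁ ▸ addOrderOf_dvd_of_nsmul_eq_zero h2
    rw [pow_mul, g_pow_m, one_pow]

instance : IsCancelSMul D.G D.A :=
  isCancelSMul_iff_eq_one_of_smul_eq.mpr D.free_G

instance : DiscreteTopology D.Λ₁ := D.abelian₁.discrete

instance : DiscreteTopology D.Λ₂ := D.abelian₂.discrete

instance : Finite D.T₁ := D.finite_T₁

instance : Finite D.T := by
  have : Finite (D.T₁.subtype.prod (D.T₂.subtype.comp D.ψ.toAddMonoidHom)).range :=
    Set.finite_range _
  exact this

instance : IsClosed (D.Λ₁ : Set V₁) := AddSubgroup.isClosed_of_discrete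

instance : IsClosed (D.Λ₂ : Set V₂) := AddSubgroup.isClosed_of_discrete

instance : IsClosed (D.T : Set (D.A₁ × D.A₂)) := (Set.finite_range _).isClosed

lemma continuous_g : Continuous D.g := by
  have h2 : Continuous D.α₂bar :=
    QuotientAddGroup.isOpenQuotientMap_mk.continuous_comp_iff.mp
      (QuotientAddGroup.continuous_mk.comp D.α₂.continuous)
  refine QuotientAddGroup.isOpenQuotientMap_mk.continuous_comp_iff.mp ?_
  have : D.g ∘ ((↑) : D.A₁ × D.A₂ → D.A) =
      fun x => (((x.1 + D.β₁, D.α₂bar x.2) : D.A₁ × D.A₂) : D.A) := by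
    funext x
    exact D.g_mk x.1 x.2
  rw [this]
  exact QuotientAddGroup.continuous_mk.comp (by fun_prop)

instance : ContinuousConstSMul D.G D.A where
  continuous_const_smul := by
    rintro ⟨h, hh⟩
    obtain ⟨k, rfl⟩ := D.exists_pow_of_mem_G hh
    change Continuous (⇑(D.g ^ k))
    rw [Equiv.Perm.coe_pow]
    exact D.continuous_g.iterate k

lemma isLocalHomeomorph_toA : IsLocalHomeomorph D.toA := by
  have h1 : IsLocalHomeomorph ((↑) : V₁ → D.A₁) :=
    (AddSubgroup.isAddQuotientCoveringMap_of_comm D.Λ₁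
      ⟨D.abelian₁.discrete⟩).isCoveringMap.isLocalHomeomorph
  have h2 : IsLocalHomeomorph ((↑) : V₂ → D.A₂) :=
    (AddSubgroup.isAddQuotientCoveringMap_of_comm D.Λ₂
      ⟨D.abelian₂.discrete⟩).isCoveringMap.isLocalHomeomorph
  have h3 : IsLocalHomeomorph ((↑) : D.A₁ × D.A₂ → D.A) :=
    (AddSubgroup.isAddQuotientCoveringMap_of_comm D.T
      (Set.finite_range _).isDiscrete).isCoveringMap.isLocalHomeomorph
  have h4 : IsLocalHomeomorph (Prod.map ((↑) : V₁ → D.A₁) ((↑) : V₂ → D.A₂)) := by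
    refine IsLocalHomeomorph.mk _ fun x => ?_
    obtain ⟨e, he, hee⟩ := h1 x.1
    obtain ⟨f, hf, hff⟩ := h2 x.2
    refine ⟨e.prod f, ⟨he, hf⟩, ?_⟩
    intro y _
    rw [hee, hff]
    rfl
  exact h3.comp h4

lemma surjective_toA : Function.Surjective D.toA := by
  intro a
  induction a using QuotientAddGroup.induction_on with
  | H x =>
    obtain ⟨a₁, a₂⟩ := x
    induction a₁ using QuotientAddGroup.induction_on with
    | H v =>
      induction a₂ using QuotientAddGroup.induction_on with
      | H w => exact ⟨(v, w), rfl⟩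

lemma surjective_p : Function.Surjective D.p :=
  Quotient.mk_surjective.comp D.surjective_toA

/-- Points of `V₁ × V₂` over the same point of `X` are related by an affine deck
transformation. -/
lemma exists_deck {v w : V₁ × V₂} (h : D.p v = D.p w) :
    ∃ φ : V₁ × V₂ → V₁ × V₂, ContDiff ℂ ω φ ∧ φ v = w ∧ ∀ u, D.p (φ u) = D.p u := by
  obtain ⟨⟨s, hs⟩, hsv⟩ := (Quotient.eq''.mp h.symm : D.toA w ∈ MulAction.orbit D.G (D.toA v))
  obtain ⟨k, rfl⟩ := D.exists_pow_of_mem_G hs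
  replace hsv : (D.g ^ k) (D.toA v) = D.toA w := hsv
  obtain ⟨b, hb⟩ := QuotientAddGroup.mk_surjective D.β₁
  let γ : V₁ × V₂ → V₁ × V₂ := fun v => (v.1 + b, D.α₂ v.2)
  have hγ : ContDiff ℂ ω γ :=
    (contDiff_fst.add contDiff_const).prodMk (D.α₂.contDiff.comp contDiff_snd)
  have hγk : ContDiff ℂ ω γ^[k] := by
    clear hsv hs
    induction k with
    | zero => exact contDiff_id
    | succ k ih => rw [Function.iterate_succ']; exact hγ.comp ih
  have hA : ∀ u, D.toA (γ^[k] u) = (D.g ^ k) (D.toA u) := by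
    clear hsv hs hγk
    intro u
    induction k with
    | zero => simp
    | succ k ih =>
      rw [Function.iterate_succ_apply', pow_succ', Equiv.Perm.mul_apply, ← ih, D.g_toA b hb]
  have hc : D.toA (w - γ^[k] v) = 0 := by rw [map_sub, hA, hsv, sub_self]
  refine ⟨fun u => γ^[k] u + (w - γ^[k] v), hγk.add contDiff_const, by simp, fun u => ?_⟩
  unfold p
  rw [map_add, hc, add_zero, hA]
  exact Quotient.sound (s := MulAction.orbitRel D.G D.A) ⟨⟨D.g ^ k, hs⟩, rfl⟩

/-- The quotient group `A₁ / (T₁ + ⟨β₁⟩)`. -/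
abbrev B : Type _ := D.A₁ ⧸ (D.T₁ ⊔ AddSubgroup.zmultiples D.β₁)

/-- The homomorphism `A → A₁ / (T₁ + ⟨β₁⟩)` induced by the first projection. -/
def AtoB : D.A →+ D.B :=
  QuotientAddGroup.lift D.T ((QuotientAddGroup.mk' _).comp (AddMonoidHom.fst D.A₁ D.A₂)) (by
    rintro _ ⟨t, rfl⟩
    exact (QuotientAddGroup.eq_zero_iff _).mpr (AddSubgroup.mem_sup_left t.2))

lemma AtoB_g (a : D.A) : D.AtoB (D.g a) = D.AtoB a := by
  induction a using QuotientAddGroup.induction_on with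
  | H x =>
    obtain ⟨a₁, a₂⟩ := x
    rw [g_mk]
    change ((a₁ + D.β₁ : D.A₁) : D.B) = ((a₁ : D.A₁) : D.B)
    rw [QuotientAddGroup.mk_add, add_eq_left]
    exact (QuotientAddGroup.eq_zero_iff _).mpr
      (AddSubgroup.mem_sup_right (AddSubgroup.mem_zmultiples _))

/-- The map `X → A₁ / (T₁ + ⟨β₁⟩)` induced by the first projection `A₁ × A₂ → A₁`. -/
def XtoB : D.X → D.B :=
  Quotient.lift D.AtoB (by
    rintro _ b ⟨⟨s, hs⟩, rfl⟩
    obtain ⟨k, rfl⟩ := D.exists_pow_of_mem_G hs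
    change D.AtoB ((D.g ^ k) b) = D.AtoB b
    clear hs
    induction k with
    | zero => simp
    | succ k ih => rw [pow_succ', Equiv.Perm.mul_apply, AtoB_g, ih])

lemma contDiffOn_transition (e e' : OpenPartialHomeomorph D.X (V₁ × V₂))
    (he : ∀ v, e.symm v = D.p v) (he' : ∀ v, e'.symm v = D.p v) :
    ContDiffOn ℂ ω (e' ∘ e.symm) (e.symm ≫ₕ e').source := by
  intro v hv
  have hv1 : v ∈ e.target := by simpa using hv.1
  have hv2 : e.symm v ∈ e'.source := hv.2
  obtain ⟨φ, hφ, hφv, hφp⟩ := D.exists_deck (v := v) (w := e' (e.symm v))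
    (by rw [← he' (e' _), e'.left_inv hv2, he])
  have h1 : ∀ᶠ u in 𝓝 v, φ u ∈ e'.target :=
    hφ.continuous.continuousAt.eventually_mem
      (by rw [hφv]; exact e'.open_target.mem_nhds (e'.map_source hv2))
  have h2 : e' ∘ e.symm =ᶠ[𝓝 v] φ := by
    filter_upwards [h1] with u hu
    rw [Function.comp_apply, he, ← hφp u, ← he' (φ u), e'.right_inv hu]
  exact (hφ.contDiffAt.congr_of_eventuallyEq h2).contDiffWithinAt

variable [FiniteDimensional ℂ V₁] [FiniteDimensional ℂ V₂]

lemma isLocalHomeomorph_p : IsLocalHomeomorph D.p := by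
  have := FiniteDimensional.proper ℂ V₁
  have := FiniteDimensional.proper ℂ V₂
  have h : IsLocalHomeomorph D.mkX :=
    (isQuotientCoveringMap_quotientMk_of_properlyDiscontinuousSMul
      (G := D.G) (E := D.A)).isCoveringMap.isLocalHomeomorph
  exact h.comp D.isLocalHomeomorph_toA

/-- The complex structure on `X`: the charts are the local inverses of `V₁ × V₂ → X`. -/
instance : ChartedSpace (V₁ × V₂) D.X :=
  letI := chartedSpaceSelf (V₁ × V₂)
  D.isLocalHomeomorph_p.chartedSpace D.surjective_p

instance : IsManifold 𝓘(ℂ, V₁ × V₂) ω D.X := by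
  refine isManifold_of_contDiffOn _ _ _ ?_
  rintro _ _ ⟨x, rfl⟩ ⟨y, rfl⟩
  have key : ∀ z, ∀ v, ((D.isLocalHomeomorph_p.localInverseAt z).trans
      (chartAt (V₁ × V₂) z)).symm v = D.p v := by
    intro z v
    simp [chartAt_self_eq]
  have := D.contDiffOn_transition _ _ (key (D.surjective_p.hasRightInverse.choose x))
    (key (D.surjective_p.hasRightInverse.choose y))
  refine this.mono ?_
  intro v hv
  exact hv.1

end BagneraDeFranchis

end

/-!
The pullback of a holomorphic one-form along `p : V₁ × V₂ → X` has coefficients periodic under the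
lattices `Λ₁` and `Λ₂`, so it is a constant form by Liouville's theorem. It is invariant under the
linear part `1 × α₂` of the lifts of `g`, and `α₂ - 1` is surjective, so it vanishes on `V₂`.
Conversely every linear form on `V₁` is invariant under the linear parts of all deck transformations
and descends to `X`. Hence `V₁` and `H⁰(X, Ω¹)` are in perfect duality. Lifting a path to
`V₁ × V₂`, its integrals are the pairings with its displacement in `V₁`; a displacement comes from a
loop exactly when it lies over `T₁ + ⟨β₁⟩`, as the `V₂`-component of the lift can be adjusted along
the graph of `ψ`.
-/

section RestrictScalars

variable {𝕜 𝕜' E F X Y : Type*} [NontriviallyNormedField 𝕜] [NontriviallyNormedField 𝕜']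
  [NormedAlgebra 𝕜 𝕜']
  [NormedAddCommGroup E] [NormedSpace 𝕜 E] [NormedSpace 𝕜' E] [IsScalarTower 𝕜 𝕜' E]
  [NormedAddCommGroup F] [NormedSpace 𝕜 F] [NormedSpace 𝕜' F] [IsScalarTower 𝕜 𝕜' F]
  [TopologicalSpace X] [ChartedSpace E X] [TopologicalSpace Y] [ChartedSpace F Y]
  {n : WithTop ℕ∞} {f : X → Y} {s : Set X} {x : X}

variable (𝕜) in
lemma contMDiffOn_restrictScalars (h : ContMDiffOn 𝓘(𝕜', E) 𝓘(𝕜', F) n f s) :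
    ContMDiffOn 𝓘(𝕜, E) 𝓘(𝕜, F) n f s := fun y hy => by
  obtain ⟨hcont, hdiff⟩ := contMDiffWithinAt_iff.mp (h y hy)
  exact contMDiffWithinAt_iff.mpr ⟨hcont, hdiff.restrict_scalars 𝕜⟩

variable (𝕜) in
lemma isLocalDiffeomorphAt_restrictScalars (h : IsLocalDiffeomorphAt 𝓘(𝕜', E) 𝓘(𝕜', F) n f x) :
    IsLocalDiffeomorphAt 𝓘(𝕜, E) 𝓘(𝕜, F) n f x := by
  obtain ⟨Φ, hx, hf⟩ := h
  exact ⟨{ Φ with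
    contMDiffOn_toFun := contMDiffOn_restrictScalars 𝕜 Φ.contMDiffOn_toFun
    contMDiffOn_invFun := contMDiffOn_restrictScalars 𝕜 Φ.contMDiffOn_invFun }, hx, hf⟩

variable (𝕜) in
lemma hasMFDerivAt_restrictScalars {f' : E →L[𝕜'] F}
    (h : HasMFDerivAt 𝓘(𝕜', E) 𝓘(𝕜', F) f x f') :
    HasMFDerivAt 𝓘(𝕜, E) 𝓘(𝕜, F) f x (f'.restrictScalars 𝕜) :=
  ⟨h.1, h.2.restrictScalars 𝕜⟩

end RestrictScalars

lemma contMDiffWithinAt_of_comp_isLocalDiffeomorphAt {𝕜 E H F H' G H'' M N P : Type*}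
    [NontriviallyNormedField 𝕜]
    [NormedAddCommGroup E] [NormedSpace 𝕜 E] [TopologicalSpace H] {I : ModelWithCorners 𝕜 E H}
    [NormedAddCommGroup F] [NormedSpace 𝕜 F] [TopologicalSpace H'] {J : ModelWithCorners 𝕜 F H'}
    [NormedAddCommGroup G] [NormedSpace 𝕜 G] [TopologicalSpace H''] {K : ModelWithCorners 𝕜 G H''}
    [TopologicalSpace M] [ChartedSpace H M] [TopologicalSpace N] [ChartedSpace H' N]
    [TopologicalSpace P] [ChartedSpace H'' P]
    {n : WithTop ℕ∞} {p : N → P} {u : M → N} {s : Set M} {x : M}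
    (hp : IsLocalDiffeomorphAt J K n p (u x)) (hu : ContinuousWithinAt u s x)
    (hpu : ContMDiffWithinAt I K n (p ∘ u) s x) : ContMDiffWithinAt I J n u s x := by
  have hinv : hp.localInverse ∘ p ∘ u =ᶠ[𝓝[s] x] u :=
    hu.eventually hp.localInverse_eventuallyEq_left
  have hinv_x : hp.localInverse (p (u x)) = u x := hp.localInverse_eventuallyEq_left.self_of_nhds
  exact (hp.localInverse_contMDiffAt.comp_contMDiffWithinAt x hpu).congr_of_eventuallyEq
    hinv.symm hinv_x.symm

lemma apply_eq_of_differentiable_of_isZLattice_periodic {V F : Type*}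
    [NormedAddCommGroup V] [NormedSpace ℂ V]
    [FiniteDimensional ℂ V] [NormedAddCommGroup F] [NormedSpace ℂ F]
    (L : Submodule ℤ V) [DiscreteTopology L] [IsZLattice ℝ L] {f : V → F} (hf : Differentiable ℂ f)
    (hper : ∀ z, ∀ w ∈ L, f (z + w) = f z) (x y : V) : f x = f y := by
  have : FiniteDimensional ℝ V := FiniteDimensional.complexToReal V
  exact hf.apply_eq_apply_of_bounded
    (IsZLattice.isCompact_range_of_periodic L f hf.continuous hper).isBounded x y

lemma IsAbelianVariety.apply_eq_of_periodic {V F : Type*} [NormedAddCommGroup V] [NormedSpace ℂ V]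
    [FiniteDimensional ℂ V] [NormedAddCommGroup F] [NormedSpace ℂ F]
    {L : AddSubgroup V} (hL : IsAbelianVariety L) {f : V → F} (hf : Differentiable ℂ f)
    (hper : ∀ z, ∀ w ∈ L, f (z + w) = f z) (x y : V) : f x = f y := by
  have : DiscreteTopology (AddSubgroup.toIntSubmodule L) := hL.discrete
  have : IsZLattice ℝ (AddSubgroup.toIntSubmodule L) := ⟨hL.span_eq_top⟩
  exact apply_eq_of_differentiable_of_isZLattice_periodic (AddSubgroup.toIntSubmodule L) hf hper x y

section PathLifting

open unitInterval

/-- Every path in `X` lifts along `f`, without prescribing the starting point of the lift. -/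
def LiftsPaths {E X : Type*} [TopologicalSpace E] [TopologicalSpace X] (f : E → X) : Prop :=
  ∀ γ : C(I, X), ∃ Γ : C(I, E), f ∘ Γ = γ

variable {E F X Y : Type*} [TopologicalSpace E] [TopologicalSpace F] [TopologicalSpace X]
  [TopologicalSpace Y]

lemma LiftsPaths.comp {f : F → X} {g : E → F} (hf : LiftsPaths f) (hg : LiftsPaths g) :
    LiftsPaths (f ∘ g) := fun γ => by
  obtain ⟨Γ, hΓ⟩ := hf γ
  obtain ⟨Δ, hΔ⟩ := hg Γ
  exact ⟨Δ, by rw [Function.comp_assoc, hΔ, hΓ]⟩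

lemma LiftsPaths.prodMap {f : E → X} {g : F → Y} (hf : LiftsPaths f) (hg : LiftsPaths g) :
    LiftsPaths (Prod.map f g) := fun γ => by
  obtain ⟨Γ, hΓ⟩ := hf (ContinuousMap.fst.comp γ)
  obtain ⟨Δ, hΔ⟩ := hg (ContinuousMap.snd.comp γ)
  exact ⟨Γ.prodMk Δ, funext fun t => Prod.ext (congrFun hΓ t) (congrFun hΔ t)⟩

lemma LiftsPaths.of_isCoveringMap {p : E → X} (hp : IsCoveringMap p) (hsurj : p.Surjective) :
    LiftsPaths p := fun γ => by
  obtain ⟨e, he⟩ := hsurj (γ 0)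
  obtain ⟨Γ, hΓ, -⟩ := hp.exists_path_lifts γ e he.symm
  exact ⟨Γ, hΓ⟩

lemma LiftsPaths.exists_continuous_lift {p : E → X} (hp : LiftsPaths p) {γ : ℝ → X}
    (hγ : ContinuousOn γ (Icc 0 1)) :
    ∃ u : ℝ → E, Continuous u ∧ EqOn (p ∘ u) γ (Icc 0 1) := by
  obtain ⟨Γ, hΓ⟩ := hp ⟨_, hγ.domRestrict⟩
  refine ⟨IccExtend zero_le_one Γ, Γ.continuous.Icc_extend', fun t ht => ?_⟩
  rw [Function.comp_apply, IccExtend_of_mem _ _ ht]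
  exact congrFun hΓ ⟨t, ht⟩

end PathLifting

lemma IsC1Path.exists_contDiffOn_lift {E F X : Type*} [NormedAddCommGroup E] [NormedSpace ℂ E]
    [NormedAddCommGroup F] [NormedSpace ℂ F] [TopologicalSpace X] [ChartedSpace E X]
    {γ : ℝ → X} (hγ : IsC1Path E γ) {p : F → X} (hp : LiftsPaths p)
    (hdiff : IsLocalDiffeomorph 𝓘(ℂ, F) 𝓘(ℂ, E) 1 p) :
    ∃ u : ℝ → F, ContDiffOn ℝ 1 u (Icc 0 1) ∧ EqOn (p ∘ u) γ (Icc 0 1) := by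
  obtain ⟨u, hu, hpu⟩ := hp.exists_continuous_lift hγ.continuousOn
  refine ⟨u, fun t ht => ContMDiffWithinAt.contDiffWithinAt ?_, hpu⟩
  exact contMDiffWithinAt_of_comp_isLocalDiffeomorphAt
    (isLocalDiffeomorphAt_restrictScalars ℝ (hdiff (u t))) hu.continuousWithinAt
    ((hγ.congr hpu) t ht)

namespace HolomorphicOneForm

section Pullback

variable {E F X : Type*} [NormedAddCommGroup E] [NormedSpace ℂ E] [NormedAddCommGroup F]
  [NormedSpace ℂ F] [TopologicalSpace X] [ChartedSpace E X] [IsManifold 𝓘(ℂ, E) ω X]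
  {p : F → X}

/-- The value at `v` of the pullback of holomorphic one-forms along `p : F → X`, written in the
trivialisation of the cotangent bundle of the vector space `F`. -/
noncomputable def pullback (p : F → X) (v : F) : HolomorphicOneForm E X →ₗ[ℂ] (F →L[ℂ] ℂ) where
  toFun η := (η (p v) : E →L[ℂ] ℂ).comp (mfderiv 𝓘(ℂ, F) 𝓘(ℂ, E) p v : F →L[ℂ] E)
  map_add' _ _ := rfl
  map_smul' _ _ := rfl

lemma pullback_apply (p : F → X) (v : F) (η : HolomorphicOneForm E X) :
    pullback p v η =
      (η (p v) : E →L[ℂ] ℂ).comp (mfderiv 𝓘(ℂ, F) 𝓘(ℂ, E) p v : F →L[ℂ] E) := rfl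

lemma differentiable_pullback_apply (hp : ContMDiff 𝓘(ℂ, F) 𝓘(ℂ, E) ω p)
    (η : HolomorphicOneForm E X) (d : F) : Differentiable ℂ (fun v => pullback p v η d) := by
  have h_const : ContMDiff 𝓘(ℂ, F) (𝓘(ℂ, F).prod 𝓘(ℂ, F)) ω
      (fun v => (⟨v, d⟩ : TangentBundle 𝓘(ℂ, F) F)) :=
    contMDiff_vectorSpace_iff_contDiff.mpr contDiff_const
  have h_deriv : ContMDiff 𝓘(ℂ, F) (𝓘(ℂ, E).prod 𝓘(ℂ, E)) ω
      (fun v => (⟨p v, mfderiv 𝓘(ℂ, F) 𝓘(ℂ, E) p v d⟩ :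
        Bundle.TotalSpace E (TangentSpace 𝓘(ℂ, E) : X → Type _))) :=
    (hp.contMDiff_tangentMap (m := ω) (by simp)).comp h_const
  have h_form : ContMDiff 𝓘(ℂ, F) (𝓘(ℂ, E).prod 𝓘(ℂ, E →L[ℂ] ℂ)) ω
      (fun v => (⟨p v, η (p v)⟩ : Bundle.TotalSpace (E →L[ℂ] ℂ)
        (fun x : X => TangentSpace 𝓘(ℂ, E) x →L[ℂ] Bundle.Trivial X ℂ x))) :=
    η.contMDiff.comp hp
  intro v
  have h_apply := (Bundle.contMDiffAt_totalSpace.mp (h_form.clm_bundle_apply h_deriv v)).2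
  exact (h_apply.mdifferentiableAt (by simp)).differentiableAt

lemma pullback_comp (η : HolomorphicOneForm E X) {G : Type*} [NormedAddCommGroup G]
    [NormedSpace ℂ G] {φ : G → F} {φ' : G →L[ℂ] F} {v : G}
    (hp : MDifferentiableAt 𝓘(ℂ, F) 𝓘(ℂ, E) p (φ v)) (hφ : HasFDerivAt φ φ' v) :
    pullback (p ∘ φ) v η = (pullback p (φ v) η).comp φ' := by
  have h_chain : mfderiv 𝓘(ℂ, G) 𝓘(ℂ, E) (p ∘ φ) v =
      (mfderiv 𝓘(ℂ, F) 𝓘(ℂ, E) p (φ v)).comp φ' :=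
    (hp.hasMFDerivAt.comp v hφ.hasMFDerivAt).mfderiv
  rw [pullback_apply, h_chain]
  rfl

lemma pullback_comp_of_deck (hp : MDifferentiable 𝓘(ℂ, F) 𝓘(ℂ, E) p) {A : F →L[ℂ] F} {v w : F}
    (hA : ∀ d, p (w + A d) = p (v + d)) (η : HolomorphicOneForm E X) :
    (pullback p w η).comp A = pullback p v η := by
  have hderiv : HasFDerivAt (fun u => w + A (u - v)) A v := by
    simpa using (A.hasFDerivAt.comp v ((hasFDerivAt_id v).sub_const v)).const_add w
  have hinv : p ∘ (fun u => w + A (u - v)) = p := funext fun u => by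
    rw [Function.comp_apply, hA, add_sub_cancel]
  have h := pullback_comp η (hp _) hderiv
  rw [hinv] at h
  simpa using h.symm

end Pullback

section Integral

variable {E F X : Type*} [NormedAddCommGroup E] [NormedSpace ℂ E] [NormedAddCommGroup F]
  [NormedSpace ℂ F] [TopologicalSpace X] [ChartedSpace E X] [IsManifold 𝓘(ℂ, E) ω X]
  {p : F → X} (η : HolomorphicOneForm E X)

lemma integral_congr {γ γ' : ℝ → X} (h : EqOn γ γ' (Icc 0 1)) : η.integral γ = η.integral γ' := by
  refine intervalIntegral.integral_congr fun t ht => ?_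
  rw [uIcc_of_le zero_le_one] at ht
  have h_value : (η (γ t) : E →L[ℂ] ℂ) = η (γ' t) := by rw [h ht]
  simp only [mfderivWithin_congr h (h ht)]
  exact congrArg (fun ℓ : E →L[ℂ] ℂ => ℓ _) h_value

lemma integral_comp (hp : MDifferentiable 𝓘(ℂ, F) 𝓘(ℂ, E) p) {u : ℝ → F}
    (hu : DifferentiableOn ℝ u (Icc 0 1)) :
    η.integral (p ∘ u) =
      ∫ t in (0 : ℝ)..1, pullback p (u t) η (derivWithin u (Icc 0 1) t) := by
  refine intervalIntegral.integral_congr fun t ht => ?_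
  rw [uIcc_of_le zero_le_one] at ht
  have h_chain := (hasMFDerivAt_restrictScalars ℝ (hp (u t)).hasMFDerivAt).comp_hasMFDerivWithinAt t
    (hu t ht).hasFDerivWithinAt.hasMFDerivWithinAt
  have h_eq := h_chain.mfderivWithin
    (uniqueDiffOn_Icc zero_lt_one t ht).uniqueMDiffWithinAt
  simp only [h_eq]
  rfl

lemma integral_comp_of_pullback_const [CompleteSpace F] (hp : MDifferentiable 𝓘(ℂ, F) 𝓘(ℂ, E) p)
    (hconst : ∀ v, pullback p v η = pullback p 0 η) {u : ℝ → F} (hu : ContDiffOn ℝ 1 u (Icc 0 1)) :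
    η.integral (p ∘ u) = pullback p 0 η (u 1 - u 0) := by
  have h_int : IntervalIntegrable (derivWithin u (Icc 0 1)) MeasureTheory.volume 0 1 := by
    refine ContinuousOn.intervalIntegrable ?_
    rw [uIcc_of_le zero_le_one]
    exact hu.continuousOn_derivWithin (uniqueDiffOn_Icc zero_lt_one) le_rfl
  calc η.integral (p ∘ u)
      = ∫ t in (0 : ℝ)..1, pullback p 0 η (derivWithin u (Icc 0 1) t) := by
        simp only [η.integral_comp hp (hu.differentiableOn one_ne_zero), hconst]
    _ = pullback p 0 η (∫ t in (0 : ℝ)..1, derivWithin u (Icc 0 1) t) :=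
        (pullback p 0 η).intervalIntegral_comp_comm h_int
    _ = pullback p 0 η (u 1 - u 0) := by
        rw [intervalIntegral.integral_derivWithin_Icc_of_contDiffOn_Icc hu zero_le_one]

end Integral

end HolomorphicOneForm

/-- `p : E → X` is a global inverse of all the preferred charts of `X`, and any two points of a
fibre of `p` are exchanged by an affine deck transformation with linear part in `H`. -/
structure IsAffineUniformization {E X : Type*} [NormedAddCommGroup E] [NormedSpace ℂ E]
    [TopologicalSpace X] [ChartedSpace E X] (H : Set (E ≃L[ℂ] E)) (p : E → X) : Prop where
  chartAt_symm_apply : ∀ x v, (chartAt E x).symm v = p v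
  exists_deck : ∀ v w, p v = p w → ∃ A ∈ H, ∀ d, p (w + A d) = p (v + d)

namespace IsAffineUniformization

variable {E X : Type*} [NormedAddCommGroup E] [NormedSpace ℂ E]
  [TopologicalSpace X] [ChartedSpace E X] {H : Set (E ≃L[ℂ] E)} {p : E → X}

lemma apply_chartAt_self (hp : IsAffineUniformization H p) (x : X) : p (chartAt E x x) = x := by
  rw [← hp.chartAt_symm_apply x, (chartAt E x).left_inv (mem_chart_source E x)]

lemma surjective (hp : IsAffineUniformization H p) : p.Surjective :=
  fun x => ⟨_, hp.apply_chartAt_self x⟩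

lemma isLocalDiffeomorphAt_of_mem_chartAt_target (hp : IsAffineUniformization H p)
    {n : WithTop ℕ∞} [IsManifold 𝓘(ℂ, E) n X] {x : X} {v : E} (hv : v ∈ (chartAt E x).target) :
    IsLocalDiffeomorphAt 𝓘(ℂ, E) 𝓘(ℂ, E) n p v :=
  ⟨{ (chartAt E x).symm with
      contMDiffOn_toFun := contMDiffOn_chart_symm
      contMDiffOn_invFun := contMDiffOn_chart
      open_source := (chartAt E x).open_target
      open_target := (chartAt E x).open_source }, hv, fun u _ => (hp.chartAt_symm_apply x u).symm⟩

lemma exists_deck_to_chartAt (hp : IsAffineUniformization H p) (v : E) :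
    ∃ A ∈ H, ∀ u, p (chartAt E (p v) (p v) + A (u - v)) = p u := by
  obtain ⟨A, hAH, hA⟩ := hp.exists_deck v _ (hp.apply_chartAt_self (p v)).symm
  exact ⟨A, hAH, fun u => by rw [hA, add_sub_cancel]⟩

lemma isLocalDiffeomorph (hp : IsAffineUniformization H p) {n : WithTop ℕ∞}
    [IsManifold 𝓘(ℂ, E) n X] : IsLocalDiffeomorph 𝓘(ℂ, E) 𝓘(ℂ, E) n p := fun v => by
  obtain ⟨A, -, hA⟩ := hp.exists_deck_to_chartAt v
  let c := chartAt E (p v) (p v)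
  let φ : Diffeomorph 𝓘(ℂ, E) 𝓘(ℂ, E) E E n :=
    { (Equiv.subRight v).trans (A.toEquiv.trans (Equiv.addLeft c)) with
      contMDiff_toFun := (contDiff_const.add (A.contDiff.comp
        (contDiff_id.sub contDiff_const))).contMDiff
      contMDiff_invFun := ((A.symm.contDiff.comp
        (contDiff_const.add contDiff_id)).add contDiff_const).contMDiff }
  have hφv : φ v = c := show c + A (v - v) = c by simp
  have hpφ : p ∘ φ = p := funext hA
  have hpc : IsLocalDiffeomorphAt 𝓘(ℂ, E) 𝓘(ℂ, E) n p (φ v) :=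
    hφv ▸ hp.isLocalDiffeomorphAt_of_mem_chartAt_target (mem_chart_target E (p v))
  exact hpφ ▸ (φ.isLocalDiffeomorph v).comp (hg := hpc)

section Differential

variable [IsManifold 𝓘(ℂ, E) 1 X]

lemma mdifferentiable (hp : IsAffineUniformization H p) : MDifferentiable 𝓘(ℂ, E) 𝓘(ℂ, E) p :=
  hp.isLocalDiffeomorph.mdifferentiable one_ne_zero

lemma exists_hasMFDerivAt (hp : IsAffineUniformization H p) (v : E) :
    ∃ A ∈ H, HasMFDerivAt 𝓘(ℂ, E) 𝓘(ℂ, E) p v (A : E →L[ℂ] E) := by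
  obtain ⟨A, hAH, hA⟩ := hp.exists_deck_to_chartAt v
  refine ⟨A, hAH, (hp.mdifferentiable v).continuousAt, ?_⟩
  set c := chartAt E (p v) (p v)
  have h_deriv : HasFDerivAt (fun u => c + A (u - v)) (A : E →L[ℂ] E) v := by
    simpa using ((A : E →L[ℂ] E).hasFDerivAt.comp v ((hasFDerivAt_id v).sub_const v)).const_add c
  have h_target : ∀ᶠ u in 𝓝 v, c + A (u - v) ∈ (chartAt E (p v)).target :=
    h_deriv.continuousAt.eventually_mem ((chartAt E (p v)).open_target.mem_nhds
      (by rw [sub_self, map_zero, add_zero]; exact mem_chart_target E (p v)))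
  have h_chart : chartAt E (p v) ∘ p =ᶠ[𝓝 v] fun u => c + A (u - v) := by
    filter_upwards [h_target] with u hu
    rw [Function.comp_apply, ← hA u, ← hp.chartAt_symm_apply (p v) (c + _),
      (chartAt E (p v)).right_inv hu]
  simp only [writtenInExtChartAt, mfld_simps]
  exact (h_deriv.congr_of_eventuallyEq h_chart).hasFDerivWithinAt

lemma exists_symmL_trivializationAt_eq (hp : IsAffineUniformization H p) {x₀ x : X}
    (hx : x ∈ (chartAt E x₀).source) :
    ∃ A ∈ H, ((trivializationAt E (TangentSpace 𝓘(ℂ, E)) x₀).symmL ℂ x : E →L[ℂ] E) =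
      (A : E →L[ℂ] E) := by
  obtain ⟨A, hAH, hA⟩ := hp.exists_hasMFDerivAt (chartAt E x₀ x)
  have hsymm : ((extChartAt 𝓘(ℂ, E) x₀).symm : E → X) = p := funext (hp.chartAt_symm_apply x₀)
  refine ⟨A, hAH, (TangentBundle.symmL_trivializationAt hx).trans ?_⟩
  change (mfderivWithin 𝓘(ℂ, E) 𝓘(ℂ, E) (extChartAt 𝓘(ℂ, E) x₀).symm _ (chartAt E x₀ x) :
    E →L[ℂ] E) = (A : E →L[ℂ] E)
  rw [hsymm, ModelWithCorners.range_eq_univ, mfderivWithin_univ, hA.mfderiv]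

end Differential

section Forms

variable [IsManifold 𝓘(ℂ, E) ω X]

open HolomorphicOneForm

lemma form_ext (hp : IsAffineUniformization H p) {η η' : HolomorphicOneForm E X}
    (h : ∀ v, pullback p v η = pullback p v η') : η = η' := by
  refine ContMDiffSection.ext fun x => ?_
  obtain ⟨v, rfl⟩ := hp.surjective x
  obtain ⟨A, -, hA⟩ := hp.exists_hasMFDerivAt v
  refine ContinuousLinearMap.ext fun (d : E) => ?_
  have h_apply := DFunLike.congr_fun (h v) (A.symm d)
  rw [pullback_apply, pullback_apply, hA.mfderiv] at h_apply
  change (η (p v) : E →L[ℂ] ℂ) (A (A.symm d)) = (η' (p v) : E →L[ℂ] ℂ) (A (A.symm d)) at h_apply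
  rwa [A.apply_symm_apply] at h_apply

/-- The one-form on `X` whose pullback along `p` is the constant form `L`. In each tangent space,
trivialised by the preferred chart, it is `L` itself. -/
noncomputable def constForm (hp : IsAffineUniformization H p) (L : E →L[ℂ] ℂ)
    (hL : ∀ A ∈ H, L.comp (A : E →L[ℂ] E) = L) : HolomorphicOneForm E X where
  toFun _ := L
  contMDiff_toFun := fun x₀ => by
    refine (contMDiffAt_hom_bundle _).mpr ⟨contMDiffAt_id, ?_⟩
    refine (contMDiffAt_const (c := L)).congr_of_eventuallyEq ?_
    filter_upwards [chart_source_mem_nhds E x₀] with x hx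
    obtain ⟨A, hAH, hA⟩ := hp.exists_symmL_trivializationAt_eq hx
    calc ((Bundle.Trivial.trivialization X ℂ).continuousLinearMapAt ℂ x).comp
          (L.comp ((trivializationAt E (TangentSpace 𝓘(ℂ, E)) x₀).symmL ℂ x : E →L[ℂ] E))
        = (ContinuousLinearMap.id ℂ ℂ).comp (L.comp (A : E →L[ℂ] E)) := by
          rw [hA, Bundle.Trivial.continuousLinearMapAt_trivialization]
      _ = L := by rw [hL A hAH, ContinuousLinearMap.id_comp]

lemma pullback_constForm (hp : IsAffineUniformization H p) (L : E →L[ℂ] ℂ)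
    (hL : ∀ A ∈ H, L.comp (A : E →L[ℂ] E) = L) (v : E) :
    pullback p v (hp.constForm L hL) = L := by
  obtain ⟨A, hAH, hA⟩ := hp.exists_hasMFDerivAt v
  rw [pullback_apply, hA.mfderiv]
  exact hL A hAH

end Forms

end IsAffineUniformization

section Periods

open HolomorphicOneForm

variable {E F X : Type*} [NormedAddCommGroup E] [NormedSpace ℂ E] [NormedAddCommGroup F]
  [NormedSpace ℂ F] [TopologicalSpace X] [ChartedSpace E X]

lemma isC1Path_comp {p : F → X} (hp : ContMDiff 𝓘(ℂ, F) 𝓘(ℂ, E) 1 p) {u : ℝ → F}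
    (hu : ContDiffOn ℝ 1 u (Icc 0 1)) : IsC1Path E (p ∘ u) :=
  (contMDiffOn_restrictScalars ℝ (contMDiffOn_univ.mpr hp)).comp hu.contMDiffOn (subset_univ _)

variable [IsManifold 𝓘(ℂ, E) ω X]

/-- The transpose of the pullback of one-forms at the origin, sending `d` to the functional
`η ↦ (p^* η)_0 d`. When one-forms on `X` pull back to constant forms along `p`, this functional is
integration along the image in `X` of any path in `F` with displacement `d`. -/
noncomputable def evalPullback (p : F → X) : F →ₗ[ℂ] Module.Dual ℂ (HolomorphicOneForm E X) :=
  ((ContinuousLinearMap.coeLM ℂ).comp (pullback p 0)).flip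

lemma evalPullback_apply (p : F → X) (d : F) (η : HolomorphicOneForm E X) :
    evalPullback p d η = pullback p 0 η d := rfl

variable [CompleteSpace F] {p : F → X} (hdiff : IsLocalDiffeomorph 𝓘(ℂ, F) 𝓘(ℂ, E) 1 p)
  (hconst : ∀ (η : HolomorphicOneForm E X) v, pullback p v η = pullback p 0 η)
include hdiff hconst

lemma IsC1Path.exists_integral_eq_evalPullback {γ : ℝ → X} (hγ : IsC1Path E γ)
    (hlift : LiftsPaths p) :
    ∃ v w, p v = γ 0 ∧ p w = γ 1 ∧
      ∀ η : HolomorphicOneForm E X, evalPullback p (w - v) η = η.integral γ := by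
  obtain ⟨u, hu, hpu⟩ := hγ.exists_contDiffOn_lift hlift hdiff
  refine ⟨u 0, u 1, hpu (left_mem_Icc.mpr zero_le_one), hpu (right_mem_Icc.mpr zero_le_one),
    fun η => ?_⟩
  rw [evalPullback_apply, ← η.integral_congr hpu,
    η.integral_comp_of_pullback_const (hdiff.mdifferentiable one_ne_zero) (hconst η) hu]

lemma evalPullback_mem_periodGroup {v d : F} (h : p (v + d) = p v) :
    evalPullback p d ∈ periodGroup E X := by
  have hu : ContDiffOn ℝ 1 (fun t : ℝ => v + t • d) (Icc 0 1) := by fun_prop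
  refine AddSubgroup.subset_closure
    ⟨p ∘ fun t : ℝ => v + t • d, isC1Path_comp hdiff.contMDiff hu, by simp [h], fun η => ?_⟩
  rw [η.integral_comp_of_pullback_const (hdiff.mdifferentiable one_ne_zero) (hconst η) hu]
  simp [evalPullback_apply]

lemma periodGroup_eq_closure_image_evalPullback (hlift : LiftsPaths p) :
    periodGroup E X = AddSubgroup.closure (evalPullback p '' {d | ∃ v, p (v + d) = p v}) := by
  refine le_antisymm ((AddSubgroup.closure_le _).mpr ?_) ((AddSubgroup.closure_le _).mpr ?_)
  · rintro φ ⟨γ, hγ, hloop, hφ⟩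
    obtain ⟨v, w, hv, hw, hint⟩ :=
      IsC1Path.exists_integral_eq_evalPullback hdiff hconst hγ hlift
    refine AddSubgroup.subset_closure ⟨w - v, ⟨v, ?_⟩, LinearMap.ext fun η => ?_⟩
    · rw [add_sub_cancel, hv, hw, hloop]
    · rw [hint, hφ]
  · rintro _ ⟨d, ⟨v, hv⟩, rfl⟩
    exact evalPullback_mem_periodGroup hdiff hconst hv

lemma isAlbaneseMap_of_comp_eq_evalPullback (hlift : LiftsPaths p) {x₀ : X}
    {a : X → Albanese E X}
    (ha : ∀ v w, p v = x₀ → a (p w) = QuotientAddGroup.mk (evalPullback p (w - v))) :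
    IsAlbaneseMap E x₀ a := fun γ hγ h0 => by
  obtain ⟨v, w, hv, hw, hint⟩ :=
    IsC1Path.exists_integral_eq_evalPullback hdiff hconst hγ hlift
  exact ⟨evalPullback p (w - v), hint, by rw [← hw, ha v w (hv.trans h0)]⟩

end Periods

namespace BagneraDeFranchis

variable {V₁ V₂ : Type*} [NormedAddCommGroup V₁] [NormedSpace ℂ V₁]
  [NormedAddCommGroup V₂] [NormedSpace ℂ V₂] (D : BagneraDeFranchis V₁ V₂)

section DeckTransformations

/-- The linear part `(a₁, a₂) ↦ (a₁, α₂ᵏ a₂)` of the lifts of `gᵏ` to `V₁ × V₂`. -/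
def linearPart (k : ℕ) : (V₁ × V₂) ≃L[ℂ] (V₁ × V₂) :=
  (ContinuousLinearEquiv.refl ℂ V₁).prodCongr (D.α₂ ^ k)

lemma g_pow_toA (k : ℕ) (v : V₁ × V₂) :
    (D.g ^ k) (D.toA v) = D.toA (D.linearPart k v) + ((k • D.β₁, 0) : D.A₁ × D.A₂) := by
  refine (D.g_pow_mk k v.1 v.2).trans ?_
  rw [α₂bar_iterate]
  refine congrArg QuotientAddGroup.mk (Prod.ext rfl ?_)
  exact (add_zero _).symm

lemma p_eq_p_iff {v w : V₁ × V₂} :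
    D.p v = D.p w ↔
      ∃ k : ℕ, D.toA w = D.toA (D.linearPart k v) + ((k • D.β₁, 0) : D.A₁ × D.A₂) := by
  simp only [← g_pow_toA]
  constructor
  · intro h
    obtain ⟨⟨s, hs⟩, hsv⟩ : D.toA w ∈ MulAction.orbit D.G (D.toA v) := Quotient.eq''.mp h.symm
    obtain ⟨k, rfl⟩ := D.exists_pow_of_mem_G hs
    exact ⟨k, hsv.symm⟩
  · rintro ⟨k, hk⟩
    exact (Quotient.sound (s := MulAction.orbitRel D.G D.A)
      ⟨⟨D.g ^ k, Subgroup.npow_mem_zpowers _ k⟩, hk.symm⟩).symm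

lemma p_add_linearPart {k : ℕ} {v w : V₁ × V₂}
    (h : D.toA w = D.toA (D.linearPart k v) + ((k • D.β₁, 0) : D.A₁ × D.A₂)) (d : V₁ × V₂) :
    D.p (w + D.linearPart k d) = D.p (v + d) := by
  refine (D.p_eq_p_iff.mpr ⟨k, ?_⟩).symm
  rw [map_add, map_add, map_add, h]
  abel

lemma exists_p_add_linearPart (k : ℕ) (v : V₁ × V₂) :
    ∃ w, ∀ d, D.p (w + D.linearPart k d) = D.p (v + d) := by
  obtain ⟨w, hw⟩ := D.surjective_toA (D.toA (D.linearPart k v) + ((k • D.β₁, 0) : D.A₁ × D.A₂))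
  exact ⟨w, D.p_add_linearPart hw⟩

lemma p_add_of_mem_lattice {c : V₁ × V₂} (hc : c ∈ D.Λ₁.prod D.Λ₂) (v : V₁ × V₂) :
    D.p (v + c) = D.p v := by
  have hc_toA : D.toA c = 0 := congrArg (QuotientAddGroup.mk' D.T)
    (Prod.ext ((QuotientAddGroup.eq_zero_iff _).mpr hc.1)
      ((QuotientAddGroup.eq_zero_iff _).mpr hc.2))
  rw [p, map_add, hc_toA, add_zero, p]

end DeckTransformations

section FirstProjection

/-- The projection `V₁ → A₁ / (T₁ + ⟨β₁⟩)`. -/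
def toB : V₁ →+ D.B := (QuotientAddGroup.mk' _).comp (QuotientAddGroup.mk' D.Λ₁)

lemma toB_surjective : Function.Surjective D.toB :=
  (QuotientAddGroup.mk'_surjective _).comp (QuotientAddGroup.mk'_surjective _)

lemma XtoB_p (v : V₁ × V₂) : D.XtoB (D.p v) = D.toB v.1 := rfl

lemma exists_p_eq_p_zero {c : V₁} (hc : D.toB c = 0) : ∃ w : V₂, D.p (c, w) = D.p 0 := by
  obtain ⟨t, ht, z, hz, htz⟩ := AddSubgroup.mem_sup.mp ((QuotientAddGroup.eq_zero_iff _).mp hc)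
  have hfin : IsOfFinAddOrder D.β₁ := by
    rw [← addOrderOf_pos_iff, D.order_β₁]
    exact zero_lt_one.trans D.one_lt_m
  obtain ⟨k, rfl⟩ := hfin.mem_multiples_iff_mem_zmultiples.mpr hz
  obtain ⟨w, hw⟩ := QuotientAddGroup.mk_surjective (D.ψ ⟨t, ht⟩ : D.A₂)
  refine ⟨w, (D.p_eq_p_iff.mpr ⟨k, ?_⟩).symm⟩
  rw [map_zero, map_zero, zero_add]
  refine (QuotientAddGroup.eq.mpr ?_).symm
  refine ⟨⟨t, ht⟩, Prod.ext ?_ ?_⟩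
  · change t = -(k • D.β₁) + (c : D.A₁)
    rw [← show t + k • D.β₁ = c from htz]
    abel
  · change (D.ψ ⟨t, ht⟩ : D.A₂) = -0 + (w : D.A₂)
    rw [hw, neg_zero, zero_add]

lemma toB_eq_zero_iff {c : V₁} : D.toB c = 0 ↔ ∃ w v, D.p (v + (c, w)) = D.p v := by
  constructor
  · intro hc
    obtain ⟨w, hw⟩ := D.exists_p_eq_p_zero hc
    exact ⟨w, 0, by rw [zero_add, hw]⟩
  · rintro ⟨w, v, h⟩
    have h_toB := congrArg D.XtoB h
    rwa [XtoB_p, XtoB_p, Prod.fst_add, map_add, add_eq_left] at h_toB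

end FirstProjection

lemma surjective_α₂_sub_id [FiniteDimensional ℂ V₂] :
    Function.Surjective (fun v : V₂ => D.α₂ v - v) := by
  let f : V₂ →ₗ[ℂ] V₂ := (D.α₂.toLinearEquiv : V₂ →ₗ[ℂ] V₂) - LinearMap.id
  have hf : Function.Injective f := by
    refine (injective_iff_map_eq_zero f).mpr fun v hv => ?_
    by_contra hne
    exact D.no_eigenvalue_one (Module.End.hasEigenvalue_of_hasEigenvector
      ⟨Module.End.mem_eigenspace_iff.mpr (by rw [one_smul]; exact sub_eq_zero.mp hv), hne⟩)
  exact LinearMap.injective_iff_surjective.mp hf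

variable [FiniteDimensional ℂ V₁] [FiniteDimensional ℂ V₂]

lemma liftsPaths_p : LiftsPaths D.p := by
  have := FiniteDimensional.proper ℂ V₁
  have := FiniteDimensional.proper ℂ V₂
  have h_mkX : LiftsPaths D.mkX := .of_isCoveringMap
    (isQuotientCoveringMap_quotientMk_of_properlyDiscontinuousSMul
      (G := D.G) (E := D.A)).isCoveringMap Quotient.mk_surjective
  have h_A₁ : LiftsPaths ((↑) : V₁ → D.A₁) := .of_isCoveringMap
    (AddSubgroup.isAddQuotientCoveringMap_of_comm D.Λ₁ ⟨D.abelian₁.discrete⟩).isCoveringMap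
    QuotientAddGroup.mk_surjective
  have h_A₂ : LiftsPaths ((↑) : V₂ → D.A₂) := .of_isCoveringMap
    (AddSubgroup.isAddQuotientCoveringMap_of_comm D.Λ₂ ⟨D.abelian₂.discrete⟩).isCoveringMap
    QuotientAddGroup.mk_surjective
  have h_A : LiftsPaths ((↑) : D.A₁ × D.A₂ → D.A) := .of_isCoveringMap
    (AddSubgroup.isAddQuotientCoveringMap_of_comm D.T
      (Set.finite_range _).isDiscrete).isCoveringMap QuotientAddGroup.mk_surjective
  exact h_mkX.comp (h_A.comp (h_A₁.prodMap h_A₂))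

lemma isAffineUniformization_p : IsAffineUniformization (range D.linearPart) D.p where
  chartAt_symm_apply x v := by
    change ((D.isLocalHomeomorph_p.localInverseAt _).trans
      (@chartAt _ _ _ _ (chartedSpaceSelf (V₁ × V₂)) _)).symm v = D.p v
    simp [chartAt_self_eq]
  exists_deck v w h := by
    obtain ⟨k, hk⟩ := D.p_eq_p_iff.mp h
    exact ⟨_, mem_range_self k, D.p_add_linearPart hk⟩

lemma isLocalDiffeomorph_p (n : WithTop ℕ∞) :
    IsLocalDiffeomorph 𝓘(ℂ, V₁ × V₂) 𝓘(ℂ, V₁ × V₂) n D.p :=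
  D.isAffineUniformization_p.isLocalDiffeomorph

section Forms

open HolomorphicOneForm

variable (η : HolomorphicOneForm (V₁ × V₂) D.X)

lemma pullback_add_of_mem_lattice {c : V₁ × V₂} (hc : c ∈ D.Λ₁.prod D.Λ₂) (v : V₁ × V₂) :
    pullback D.p (v + c) η = pullback D.p v η := by
  refine pullback_comp_of_deck (A := .id ℂ _) D.isAffineUniformization_p.mdifferentiable
    (fun d => ?_) η
  rw [ContinuousLinearMap.id_apply, add_right_comm, D.p_add_of_mem_lattice hc]

lemma pullback_eq (v w : V₁ × V₂) : pullback D.p v η = pullback D.p w η := by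
  refine ContinuousLinearMap.ext fun d => ?_
  have hdiff := differentiable_pullback_apply (D.isLocalDiffeomorph_p ω).contMDiff η d
  calc pullback D.p v η d
      = pullback D.p (w.1, v.2) η d :=
        D.abelian₁.apply_eq_of_periodic (f := fun x => pullback D.p (x, v.2) η d)
          (hdiff.comp (by fun_prop)) (fun z l hl => by
            simpa using DFunLike.congr_fun
              (D.pullback_add_of_mem_lattice η (c := (l, 0)) ⟨hl, zero_mem _⟩ (z, v.2)) d) v.1 w.1
    _ = pullback D.p w η d :=
        D.abelian₂.apply_eq_of_periodic (f := fun y => pullback D.p (w.1, y) η d)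
          (hdiff.comp (by fun_prop)) (fun z l hl => by
            simpa using DFunLike.congr_fun
              (D.pullback_add_of_mem_lattice η (c := (0, l)) ⟨zero_mem _, hl⟩ (w.1, z)) d) v.2 w.2

lemma pullback_comp_linearPart (k : ℕ) (v : V₁ × V₂) :
    (pullback D.p v η).comp (D.linearPart k : V₁ × V₂ →L[ℂ] V₁ × V₂) = pullback D.p v η := by
  obtain ⟨w, hw⟩ := D.exists_p_add_linearPart k v
  calc (pullback D.p v η).comp (D.linearPart k : V₁ × V₂ →L[ℂ] V₁ × V₂)
      = (pullback D.p w η).comp (D.linearPart k : V₁ × V₂ →L[ℂ] V₁ × V₂) := by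
        rw [D.pullback_eq η v w]
    _ = pullback D.p v η := by
        refine pullback_comp_of_deck D.isAffineUniformization_p.mdifferentiable (fun d => ?_) η
        rw [ContinuousLinearEquiv.coe_coe, hw]

lemma pullback_apply_snd (v : V₁ × V₂) (d : V₂) : pullback D.p v η (0, d) = 0 := by
  obtain ⟨d, rfl⟩ := D.surjective_α₂_sub_id d
  have h_inv : pullback D.p v η (0, D.α₂ d) = pullback D.p v η (0, d) :=
    DFunLike.congr_fun (D.pullback_comp_linearPart η 1 v) (0, d)
  rw [← sub_self (0 : V₁), ← Prod.mk_sub_mk, map_sub, h_inv, sub_self]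

end Forms

section Albanese

open HolomorphicOneForm

/-- The pairing between `V₁` and `H⁰(X, Ω¹_X)` given by `(v, η) ↦ (p^* η)(v, 0)`. -/
noncomputable def pairing : V₁ →ₗ[ℂ] Module.Dual ℂ (HolomorphicOneForm (V₁ × V₂) D.X) :=
  evalPullback D.p ∘ₗ LinearMap.inl ℂ V₁ V₂

lemma evalPullback_eq_pairing (d : V₁ × V₂) : evalPullback D.p d = D.pairing d.1 := by
  refine LinearMap.ext fun η => ?_
  calc pullback D.p 0 η d
      = pullback D.p 0 η (d.1, 0) + pullback D.p 0 η (0, d.2) := by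
        rw [← map_add, Prod.fst_add_snd]
    _ = pullback D.p 0 η (d.1, 0) := by rw [D.pullback_apply_snd, add_zero]

lemma pairing_injective : Function.Injective D.pairing := by
  refine (injective_iff_map_eq_zero _).mpr fun v hv => ?_
  refine SeparatingDual.eq_zero_of_forall_dual_eq_zero (R := ℂ) fun ℓ => ?_
  have hL : ∀ A ∈ range D.linearPart, (ℓ.comp (.fst ℂ V₁ V₂)).comp (A : V₁ × V₂ →L[ℂ] V₁ × V₂) =
      ℓ.comp (.fst ℂ V₁ V₂) := by
    rintro _ ⟨k, rfl⟩
    rfl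
  have h_apply := LinearMap.congr_fun hv (D.isAffineUniformization_p.constForm _ hL)
  rwa [pairing, LinearMap.comp_apply, evalPullback_apply,
    D.isAffineUniformization_p.pullback_constForm] at h_apply

lemma pairing_flip_injective : Function.Injective D.pairing.flip := fun η η' h => by
  refine D.isAffineUniformization_p.form_ext fun v => ?_
  rw [D.pullback_eq η v 0, D.pullback_eq η' v 0]
  refine ContinuousLinearMap.ext fun d => ?_
  rw [← evalPullback_apply, ← evalPullback_apply, D.evalPullback_eq_pairing]
  exact LinearMap.congr_fun h d.1

instance : D.pairing.IsPerfPair := .of_injective D.pairing_injective D.pairing_flip_injective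

lemma map_ker_toB :
    D.toB.ker.map (D.pairing.toPerfPair.toAddEquiv : V₁ →+ _) = periodGroup (V₁ × V₂) D.X := by
  have h_image : evalPullback D.p '' {d | ∃ v, D.p (v + d) = D.p v} = D.pairing '' D.toB.ker := by
    ext φ
    constructor
    · rintro ⟨d, ⟨v, hv⟩, rfl⟩
      exact ⟨d.1, D.toB_eq_zero_iff.mpr ⟨d.2, v, hv⟩, (D.evalPullback_eq_pairing d).symm⟩
    · rintro ⟨c, hc, rfl⟩
      obtain ⟨w, hw⟩ := D.toB_eq_zero_iff.mp hc
      exact ⟨(c, w), hw, D.evalPullback_eq_pairing (c, w)⟩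
  rw [periodGroup_eq_closure_image_evalPullback (D.isLocalDiffeomorph_p 1)
    (fun η v => D.pullback_eq η v 0) D.liftsPaths_p, h_image]
  exact (AddSubgroup.closure_eq _).symm

/-- The isomorphism `A₁ / (T₁ + ⟨β₁⟩) ≃ Alb(X)` induced by `pairing`. -/
noncomputable def albaneseEquiv : D.B ≃+ Albanese (V₁ × V₂) D.X :=
  (QuotientAddGroup.quotientKerEquivOfSurjective D.toB D.toB_surjective).symm.trans
    (QuotientAddGroup.congr _ _ D.pairing.toPerfPair.toAddEquiv D.map_ker_toB)

lemma albaneseEquiv_toB (v : V₁) :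
    D.albaneseEquiv (D.toB v) = QuotientAddGroup.mk (D.pairing v) := by
  have h_symm : (QuotientAddGroup.quotientKerEquivOfSurjective D.toB D.toB_surjective).symm
      (D.toB v) = (v : V₁ ⧸ D.toB.ker) :=
    (AddEquiv.symm_apply_eq _).mpr rfl
  rw [albaneseEquiv, AddEquiv.trans_apply, h_symm]
  rfl

end Albanese

end BagneraDeFranchis

/-- The Albanese variety of `X = A / G`, `A = (A₁ × A₂) / T`, is `A₁ / (T₁ + ⟨β₁⟩)`: there is a group
isomorphism `e` which lifts to a `ℂ`-linear isomorphism `F` of the universal covers (so it is an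
isomorphism of complex tori), and under it the map `X → A₁ / (T₁ + ⟨β₁⟩)` induced by the first
projection becomes the Albanese map, for every base point. -/
theorem mainTheorem9 {V₁ V₂ : Type*}
    [NormedAddCommGroup V₁] [NormedSpace ℂ V₁] [FiniteDimensional ℂ V₁]
    [NormedAddCommGroup V₂] [NormedSpace ℂ V₂] [FiniteDimensional ℂ V₂]
    (D : BagneraDeFranchis V₁ V₂) :
    ∃ (F : V₁ ≃ₗ[ℂ] Module.Dual ℂ (HolomorphicOneForm (V₁ × V₂) D.X))
      (e : D.A₁ ⧸ (D.T₁ ⊔ AddSubgroup.zmultiples D.β₁) ≃+ Albanese (V₁ × V₂) D.X),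
      (∀ v : V₁, e ((v : D.A₁) : D.A₁ ⧸ (D.T₁ ⊔ AddSubgroup.zmultiples D.β₁)) =
        (F v : Albanese (V₁ × V₂) D.X)) ∧
      ∀ x₀ : D.X, IsAlbaneseMap (V₁ × V₂) x₀ (fun x => e (D.XtoB x - D.XtoB x₀)) := by
  refine ⟨D.pairing.toPerfPair, D.albaneseEquiv, D.albaneseEquiv_toB, fun x₀ => ?_⟩
  refine isAlbaneseMap_of_comp_eq_evalPullback (D.isLocalDiffeomorph_p 1)
    (fun η v => D.pullback_eq η v 0) D.liftsPaths_p fun v w hv => ?_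
  rw [← hv, D.XtoB_p, D.XtoB_p, ← map_sub, D.albaneseEquiv_toB, D.evalPullback_eq_pairing,
    Prod.fst_sub]
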